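/- For $t\in(0,1]$ put $C_t=(144/t)^2$, so that $C_{0.5}=288^2$. There are universal constants $c',C_0,C'>0$ such that the following holds for all $d\ge 1$ and $n\ge 2$. Let $X_1,\dots,X_n$ be independent random vectors in $\mathbb R^d$ with laws $P_1,\dots,P_n$, and suppose that the mixture $\overline P=\frac1n\sum_{i=1}^n P_i$ has a Lebesgue density that is radially symmetric and unimodal about the origin, i.e. of the form $g(\|x\|_2)$ with $g$ nonincreasing on $[0,\infty)$. For $x\in\mathbb R^d$ and $r\ge0$ let $f_{x,r}$ be the indicator function of the closed Euclidean ball of radius $r$ centred at $x$, let $R_n(f)=\frac1n\sum_i f(X_i)$ and $R(f)=\frac1n\sum_i\mathbb E f(X_i)$, and let $R^*_r=\sup\{R(f_{x,s}) : x\in\mathbb R^d,\ 0\le s\le r\}$. The modal-ball estimator $\widehat\mu_{M,r}$ is a maximizer of $x\mapsto R_n(f_{x,r})$ over $\mathbb R^d$, with ties broken arbitrarily. (i) If $r>0$ satisfies $$R^*_r\ \ge\ C_{0.5}\,\frac{(d+1)\log n}{n},\qquad(\ast)$$ then with probability at least $1-2\exp(-c'd\log n)$, $$\|\widehat\mu_{M,r}\|_2\le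 4r\left(\frac{2}{R^*_r}\right)^{1/d}.$$ (ii) Suppose in addition that the $X_i$ have common mean $0$. Let $\sigma_i\in[0,\infty]$ be the marginal standard deviation of $X_i$, i.e. $\sigma_i^2=\frac1d\operatorname{tr}\operatorname{Cov}(X_i)$ (so $\operatorname{Cov}(X_i)=\sigma_i^2I_d$ when $P_i$ is radially symmetric with finite variance), with $\sigma_i=\infty$ if $X_i$ has no finite second moment, and let $\sigma_{(k)}$ be the $k$-th smallest of $\sigma_1,\dots,\sigma_n$. Let $C\ge C_0$ and write $\sigma_{(2Cd\log n)}$ for $\sigma_{(\lceil 2Cd\log n\rceil)}$; assume that $\lceil 2Cd\log n\rceil\le n$ and that $\sigma_{(2Cd\log n)}<\infty$. Then the radius $r=2\sqrt d\,\sigma_{(2Cd\log n)}$ satisfies $(\ast)$. Moreover, for this $r$, and more generally for every $0<r\le 2\sqrt d\,\sigma_{(2Cd\log n)}$ that satisfies $(\ast)$, with probability at least $1-2\exp(-c'd\log n)$, $$\|\widehat\mu_{M,r}\|_2\ \le\ 8\sqrt d\,\sigma_{(2Cd\log n)}\left(\frac{2}{R^*_r}\right)^{1/d}\ \le\ 8\sqrt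 d\left(\frac{n}{C'd\log n}\right)^{1/d}\sigma_{(2Cd\log n)}.$$ -/

import Mathlib

open MeasureTheory ProbabilityTheory

namespace ModalBall

/-- The indicator function `f_{x,r}` of the closed Euclidean ball of radius `r` centred at `x`. -/
noncomputable def ballIndicator {d : ℕ} (x : EuclideanSpace ℝ (Fin d)) (r : ℝ) :
    EuclideanSpace ℝ (Fin d) → ℝ :=
  (Metric.closedBall x r).indicator 1

/-- `R_n(f)`: the expectation of `f` under the empirical distribution of `x_1, …, x_n`. -/
noncomputable def empiricalRisk {d n : ℕ} (x : Fin n → EuclideanSpace ℝ (Fin d))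
    (f : EuclideanSpace ℝ (Fin d) → ℝ) : ℝ :=
  (1 / (n : ℝ)) * ∑ i, f (x i)

/-- `R(f) = (1/n) ∑ i, E f(X_i)`, where `X_i` has law `P i`. -/
noncomputable def populationRisk {d n : ℕ} (P : Fin n → Measure (EuclideanSpace ℝ (Fin d)))
    (f : EuclideanSpace ℝ (Fin d) → ℝ) : ℝ :=
  (1 / (n : ℝ)) * ∑ i, ∫ z, f z ∂(P i)

/-- The class `H_r` of indicators of balls of radius at most `r`. -/
def ballClass (d : ℕ) (r : ℝ) : Set (EuclideanSpace ℝ (Fin d) → ℝ) :=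
  {f | ∃ (x : EuclideanSpace ℝ (Fin d)) (s : ℝ), 0 ≤ s ∧ s ≤ r ∧ f = ballIndicator x s}

/-- `R*_r`, the supremum of `R(f)` over `f ∈ H_r` (a set of reals that is bounded above by `1`,
and nonempty for `r ≥ 0`). -/
noncomputable def RStar {d n : ℕ} (P : Fin n → Measure (EuclideanSpace ℝ (Fin d)))
    (r : ℝ) : ℝ :=
  sSup (populationRisk P '' ballClass d r)

/-- `m` is a possible value of the `r`-modal ball estimator on the data `x_1, …, x_n`:
it maximizes `R_n(f_{y,r})` over all centres `y ∈ ℝ^d`. -/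
def IsModalBallCenter {d n : ℕ} (x : Fin n → EuclideanSpace ℝ (Fin d)) (r : ℝ)
    (m : EuclideanSpace ℝ (Fin d)) : Prop :=
  ∀ y, empiricalRisk x (ballIndicator y r) ≤ empiricalRisk x (ballIndicator m r)

/-- The mixture distribution `(1/n) ∑ i, P_i`. -/
noncomputable def mixture {d n : ℕ} (P : Fin n → Measure (EuclideanSpace ℝ (Fin d))) :
    Measure (EuclideanSpace ℝ (Fin d)) :=
  (n : ENNReal)⁻¹ • ∑ i, P i

/-- `Q` has a Lebesgue density that is radially symmetric and unimodal about the origin,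
i.e. of the form `g(‖x‖)` with `g` nonincreasing on `[0, ∞)`. -/
def IsRadialUnimodal {d : ℕ} (Q : Measure (EuclideanSpace ℝ (Fin d))) : Prop :=
  ∃ g : ℝ → ENNReal, AntitoneOn g (Set.Ici 0) ∧ Q = volume.withDensity (fun x => g ‖x‖)

/-- The marginal standard deviation `σ ∈ [0, ∞]` of a distribution `Q` on `ℝ^d`, given by
`σ² = tr(Cov Q) / d`. If `Cov Q = s² I_d`, in particular if `Q` is radially symmetric, then `σ = s`
is the standard deviation of every coordinate. It is `∞` if `Q` has no finite second moment. -/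
noncomputable def marginalSD {d : ℕ} (Q : Measure (EuclideanSpace ℝ (Fin d))) : ENNReal :=
  ((∑ j, evariance (fun z : EuclideanSpace ℝ (Fin d) => z j) Q) / (d : ENNReal)) ^ (1 / 2 : ℝ)

/-- The `k`-th smallest of the `n` values `a_1, …, a_n`, for `1 ≤ k ≤ n`: the least `t` such that
at least `k` of the values are `≤ t`. It is `∞` for `k > n`. -/
noncomputable def orderStat {n : ℕ} (a : Fin n → ENNReal) (k : ℕ) : ENNReal :=
  sInf {t | k ≤ Nat.card {i // a i ≤ t}}

/-- The constant `C_t = (144 / t)²`. -/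
noncomputable def concConst (t : ℝ) : ℝ := (144 / t) ^ 2

end ModalBall

/-! Put `N = n * RStar P r`. Some ball of radius at most `r` has expected count above `0.99 * N`, so
by Chernoff (`measureReal_pointCount_le`) it holds at least `3 * N / 4` points with high
probability, and so does the ball at any modal centre. A centre violating the bound is thus a far
ball with that many points. Unimodality makes the expected count of each far ball, even enlarged to
radius `5 * r / 4`, at most `N / 4` (`sum_measureReal_closedBall_le`).

The far balls are handled together without VC theory. If the ball at `m` is crowded, so are all
enlarged balls centred within `r / 4` of `m`, so the set of bad centres has at least the volume of a
ball of radius `r / 4`. Markov's inequality for that volume, with Fubini, bounds the failure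
probability (`measure_exists_pointCount_closedBall_le`). Integrating over unboundedly many centres
requires a tail bound proportional to the mean count, which is `measureReal_le_pointCount`.

The second claim adds Chebyshev: the laws with small standard deviation already put enough mass on
one centred ball. -/

namespace ModalBall

/-! ### Tail bounds for the number of points in a fixed set. -/

section Concentration

variable {E : Type*} {n : ℕ}

/-- The number of the points `x 1, …, x n` that lie in `A`. -/
noncomputable def pointCount (A : Set E) (x : Fin n → E) : ℝ :=
  ∑ i, A.indicator (1 : E → ℝ) (x i)

lemma pointCount_nonneg (A : Set E) (x : Fin n → E) : 0 ≤ pointCount A x :=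
  Finset.sum_nonneg fun i _ => Set.indicator_nonneg (fun _ _ => zero_le_one) (x i)

lemma pointCount_le (A : Set E) (x : Fin n → E) : pointCount A x ≤ n := by
  calc pointCount A x ≤ ∑ _i : Fin n, (1 : ℝ) :=
        Finset.sum_le_sum fun i _ => Set.indicator_le_self' (by simp) (x i)
    _ = n := by simp

lemma pointCount_mono {A B : Set E} (h : A ⊆ B) (x : Fin n → E) :
    pointCount A x ≤ pointCount B x :=
  Finset.sum_le_sum fun i _ =>
    Set.indicator_le_indicator_of_subset h (fun _ => zero_le_one) (x i)

variable [MeasurableSpace E]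

lemma measurable_pointCount {A : Set E} (hA : MeasurableSet A) :
    Measurable (pointCount A : (Fin n → E) → ℝ) :=
  Finset.measurable_sum _ fun i _ =>
    (measurable_one.indicator hA).comp (measurable_pi_apply i)

variable (P : Fin n → Measure E) [∀ i, IsProbabilityMeasure (P i)]

lemma integrable_exp_pointCount {A : Set E} (hA : MeasurableSet A) (θ : ℝ) :
    Integrable (fun x => Real.exp (θ * pointCount A x)) (Measure.pi P) := by
  refine Integrable.of_bound (C := Real.exp (|θ| * n))
    ((measurable_pointCount hA).const_mul θ).exp.aestronglyMeasurable (.of_forall fun x => ?_)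
  rw [Real.norm_eq_abs, Real.abs_exp, Real.exp_le_exp]
  calc θ * pointCount A x ≤ |θ| * pointCount A x :=
        mul_le_mul_of_nonneg_right (le_abs_self θ) (pointCount_nonneg A x)
    _ ≤ |θ| * n := mul_le_mul_of_nonneg_left (pointCount_le A x) (abs_nonneg θ)

/-- By independence the transform is a product of Bernoulli factors, each bounded through `1 + u ≤
exp u`; the laws need not be identical. -/
lemma integral_exp_pointCount_le {A : Set E} (hA : MeasurableSet A) (θ : ℝ) :
    ∫ x, Real.exp (θ * pointCount A x) ∂(Measure.pi P)
      ≤ Real.exp ((Real.exp θ - 1) * ∑ i, (P i).real A) := by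
  have h1 : ∀ x : Fin n → E, Real.exp (θ * pointCount A x)
      = ∏ i, (1 + (Real.exp θ - 1) * A.indicator (1 : E → ℝ) (x i)) := by
    intro x
    rw [pointCount, Finset.mul_sum, Real.exp_sum]
    refine Finset.prod_congr rfl fun i _ => ?_
    by_cases h : x i ∈ A <;> simp [h]
  simp_rw [h1]
  rw [integral_fintype_prod_eq_prod
    (f := fun _ z => 1 + (Real.exp θ - 1) * A.indicator (1 : E → ℝ) z), Finset.mul_sum,
    Real.exp_sum]
  have h2 : ∀ i, ∫ z, (1 + (Real.exp θ - 1) * A.indicator (1 : E → ℝ) z) ∂(P i)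
      = 1 + (Real.exp θ - 1) * (P i).real A := by
    intro i
    have h3 : Integrable (A.indicator (1 : E → ℝ)) (P i) := (integrable_const 1).indicator hA
    rw [integral_add (integrable_const _) (h3.const_mul _), integral_const_mul,
      integral_indicator_one hA]
    simp
  simp_rw [h2]
  refine Finset.prod_le_prod (fun i _ => ?_) fun i _ => ?_
  · have h3 : (P i).real A ≤ 1 := measureReal_le_one
    have h4 : 0 ≤ (P i).real A := measureReal_nonneg
    nlinarith [Real.exp_pos θ]
  · linarith [Real.add_one_le_exp ((Real.exp θ - 1) * (P i).real A)]

/-- Chernoff's bound for the lower tail. -/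
lemma measureReal_pointCount_le {A : Set E} (hA : MeasurableSet A) {θ : ℝ} (hθ : 0 ≤ θ)
    (k : ℝ) :
    (Measure.pi P).real {x | pointCount A x ≤ k}
      ≤ Real.exp (θ * k + (Real.exp (-θ) - 1) * ∑ i, (P i).real A) := by
  have h := mul_meas_ge_le_integral_of_nonneg (μ := Measure.pi P)
    (f := fun x => Real.exp (-θ * pointCount A x)) (.of_forall fun x => (Real.exp_pos _).le)
    (integrable_exp_pointCount P hA (-θ)) (Real.exp (-θ * k))
  have h1 : {x : Fin n → E | pointCount A x ≤ k}
      ⊆ {x | Real.exp (-θ * k) ≤ Real.exp (-θ * pointCount A x)} := by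
    intro x hx
    simp only [Set.mem_ofPred_eq, Real.exp_le_exp] at hx ⊢
    nlinarith
  have h2 := (mul_le_mul_of_nonneg_left (measureReal_mono h1) (Real.exp_pos (-θ * k)).le).trans
    (h.trans (integral_exp_pointCount_le P hA (-θ)))
  calc _ = Real.exp (θ * k) * (Real.exp (-θ * k) *
        (Measure.pi P).real {x | pointCount A x ≤ k}) := by
        rw [← mul_assoc, ← Real.exp_add]; simp
    _ ≤ _ := by rw [Real.exp_add]; gcongr

/-- An upper tail bound that is linear in the expected number of points. -/
lemma measureReal_le_pointCount {A : Set E} (hA : MeasurableSet A) {k L : ℝ} (hk : 0 < k)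
    (hL : ∑ i, (P i).real A ≤ L) :
    (Measure.pi P).real {x | k ≤ pointCount A x}
      ≤ 2 * Real.exp (2 * L) / (Real.exp k - 1) * ∑ i, (P i).real A := by
  set l := ∑ i, (P i).real A with hl
  have hl0 : 0 ≤ l := Finset.sum_nonneg fun i _ => measureReal_nonneg
  have hk1 : 0 < Real.exp k - 1 := by linarith [Real.add_one_le_exp k]
  have hint := integrable_exp_pointCount P hA 1
  -- Markov is applied to `exp S - 1` instead of `exp S`: it vanishes at `S = 0`, which yields the
  -- factor `l`.
  have h := mul_meas_ge_le_integral_of_nonneg (μ := Measure.pi P)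
    (f := fun x => Real.exp (1 * pointCount A x) - 1)
    (.of_forall fun x => by
      have := Real.one_le_exp (pointCount_nonneg A x)
      simpa using this)
    (hint.sub (integrable_const 1)) (Real.exp k - 1)
  have h1 : {x : Fin n → E | k ≤ pointCount A x}
      ⊆ {x | Real.exp k - 1 ≤ Real.exp (1 * pointCount A x) - 1} := by
    intro x hx
    simpa using hx
  have h2 := (mul_le_mul_of_nonneg_left (measureReal_mono h1) hk1.le).trans h
  rw [integral_sub hint (integrable_const 1)] at h2
  have h3 := integral_exp_pointCount_le P hA 1
  have he := Real.exp_one_lt_d9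
  have h4 : Real.exp ((Real.exp 1 - 1) * l) ≤ Real.exp (2 * l) := by
    rw [Real.exp_le_exp]; nlinarith
  have h5 : Real.exp (2 * l) - 1 ≤ 2 * l * Real.exp (2 * l) := by
    have := Real.add_one_le_exp (-(2 * l))
    have h6 : Real.exp (2 * l) * Real.exp (-(2 * l)) = 1 := by rw [← Real.exp_add]; simp
    nlinarith [Real.exp_pos (2 * l)]
  have h7 : Real.exp (2 * l) ≤ Real.exp (2 * L) := by rw [Real.exp_le_exp]; linarith
  rw [div_mul_eq_mul_div, le_div_iff₀ hk1]
  simp only [one_mul, integral_const, probReal_univ, smul_eq_mul, mul_one] at h2 h3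
  have h8 : l * Real.exp (2 * l) ≤ l * Real.exp (2 * L) := mul_le_mul_of_nonneg_left h7 hl0
  rw [← hl] at h3
  linarith

end Concentration

/-! ### Mass of far balls, and the union bound over a continuum of centres. -/

section Balls

variable {d n : ℕ}

/-- A ball far from the centre of a radial unimodal distribution has small mass. -/
lemma IsRadialUnimodal.measureReal_closedBall_mul_pow_le
    {Q : Measure (EuclideanSpace ℝ (Fin d))} [IsProbabilityMeasure Q] (hQ : IsRadialUnimodal Q)
    {x : EuclideanSpace ℝ (Fin d)} {R ρ : ℝ} (hR : 0 ≤ R) (hρ : 0 ≤ ρ) (hx : ρ + R ≤ ‖x‖) :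
    Q.real (Metric.closedBall x R) * ρ ^ d ≤ R ^ d := by
  obtain ⟨g, hg, hQg⟩ := hQ
  -- The density is at most `g ρ` on the far ball and at least `g ρ` on the centred ball of radius
  -- `ρ`, whose mass is at most 1; comparing volumes eliminates `g ρ`.
  have h1 : Q (Metric.closedBall x R) ≤ g ρ * volume (Metric.closedBall x R) := by
    rw [hQg, withDensity_apply _ Metric.isClosed_closedBall.measurableSet, ← setLIntegral_const]
    refine setLIntegral_mono measurable_const fun y hy => hg hρ (norm_nonneg y) ?_
    have h2 : ‖x - y‖ ≤ R := by rw [← dist_eq_norm, dist_comm]; exact hy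
    have h3 := norm_sub_norm_le x y
    linarith
  have h2 : g ρ * volume (Metric.closedBall (0 : EuclideanSpace ℝ (Fin d)) ρ) ≤ 1 := by
    refine le_trans ?_ (prob_le_one (μ := Q) (s := Metric.closedBall 0 ρ))
    rw [hQg, withDensity_apply _ Metric.isClosed_closedBall.measurableSet, ← setLIntegral_const]
    refine setLIntegral_mono' Metric.isClosed_closedBall.measurableSet fun y hy => ?_
    exact hg (norm_nonneg y) hρ (by simpa using hy)
  rw [Measure.addHaar_closedBall volume _ hR, finrank_euclideanSpace_fin] at h1
  rw [Measure.addHaar_closedBall volume _ hρ, finrank_euclideanSpace_fin] at h2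
  set V := volume (Metric.ball (0 : EuclideanSpace ℝ (Fin d)) 1) with hV
  have h3 : Q (Metric.closedBall x R) * ENNReal.ofReal (ρ ^ d) ≤ ENNReal.ofReal (R ^ d) := by
    calc Q (Metric.closedBall x R) * ENNReal.ofReal (ρ ^ d)
        ≤ g ρ * (ENNReal.ofReal (R ^ d) * V) * ENNReal.ofReal (ρ ^ d) := by gcongr
      _ = ENNReal.ofReal (R ^ d) * (g ρ * (ENNReal.ofReal (ρ ^ d) * V)) := by ring
      _ ≤ ENNReal.ofReal (R ^ d) * 1 := by gcongr
      _ = _ := mul_one _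
  have h4 := ENNReal.toReal_mono ENNReal.ofReal_ne_top h3
  rwa [ENNReal.toReal_mul, ENNReal.toReal_ofReal (by positivity),
    ENNReal.toReal_ofReal (by positivity)] at h4

lemma measurableSet_dist_le {E F : Type*} [PseudoMetricSpace E] [SecondCountableTopology E]
    [MeasurableSpace E] [BorelSpace E] [MeasurableSpace F] (R : ℝ) {f : F → E}
    (hf : Measurable f) : MeasurableSet {p : E × F | dist (f p.2) p.1 ≤ R} :=
  measurableSet_le ((hf.comp measurable_snd).dist measurable_fst) measurable_const

/-- Fubini: a fixed point is covered by exactly the centres in a ball around it. -/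
lemma lintegral_measure_closedBall (Q : Measure (EuclideanSpace ℝ (Fin d)))
    [IsProbabilityMeasure Q] (R : ℝ) :
    ∫⁻ m, Q (Metric.closedBall m R)
      = volume (Metric.closedBall (0 : EuclideanSpace ℝ (Fin d)) R) := by
  have hT := measurableSet_dist_le (E := EuclideanSpace ℝ (Fin d)) R measurable_id
  have h1 := Measure.prod_apply (μ := volume) (ν := Q) hT
  have h2 := Measure.prod_apply_symm (μ := volume) (ν := Q) hT
  have h3 : ∀ y : EuclideanSpace ℝ (Fin d),
      volume ((fun x => (x, y)) ⁻¹' {p : EuclideanSpace ℝ (Fin d) × EuclideanSpace ℝ (Fin d) |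
        dist (id p.2) p.1 ≤ R}) = volume (Metric.closedBall (0 : EuclideanSpace ℝ (Fin d)) R) := by
    intro y
    rw [← Measure.addHaar_closedBall_center volume y R]
    congr 1
    ext x
    simp [dist_comm]
  simp_rw [h3, lintegral_const, measure_univ, mul_one] at h2
  rw [← h2, h1]
  rfl

lemma measurable_pointCount_closedBall (R : ℝ) :
    Measurable fun p : EuclideanSpace ℝ (Fin d) × (Fin n → EuclideanSpace ℝ (Fin d)) =>
      pointCount (Metric.closedBall p.1 R) p.2 := by
  refine Finset.measurable_sum _ fun i _ => ?_
  have h : (fun p : EuclideanSpace ℝ (Fin d) × (Fin n → EuclideanSpace ℝ (Fin d)) =>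
      (Metric.closedBall p.1 R).indicator (1 : EuclideanSpace ℝ (Fin d) → ℝ) (p.2 i))
      = {p | dist (p.2 i) p.1 ≤ R}.indicator fun _ => 1 := by
    ext p
    by_cases hp : dist (p.2 i) p.1 ≤ R <;> simp [hp]
  rw [h]
  exact measurable_const.indicator
    (measurableSet_dist_le R (f := fun x : Fin n → EuclideanSpace ℝ (Fin d) => x i)
      (measurable_pi_apply i))

variable (P : Fin n → Measure (EuclideanSpace ℝ (Fin d))) [∀ i, IsProbabilityMeasure (P i)]

/-- A union bound over all balls with centre outside a ball around the origin. -/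
lemma measure_exists_pointCount_closedBall_le {r δ ρ k K : ℝ} (hr : 0 ≤ r) (hδ : 0 < δ)
    (hK : 0 ≤ K)
    (h : ∀ m : EuclideanSpace ℝ (Fin d), ρ ≤ ‖m‖ →
      (Measure.pi P).real {x | k ≤ pointCount (Metric.closedBall m (r + δ)) x}
        ≤ K * ∑ i, (P i).real (Metric.closedBall m (r + δ))) :
    Measure.pi P {x | ∃ m, ρ + δ ≤ ‖m‖ ∧ k ≤ pointCount (Metric.closedBall m r) x}
      ≤ ENNReal.ofReal (K * n * ((r + δ) / δ) ^ d) := by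
  set T : Set (EuclideanSpace ℝ (Fin d) × (Fin n → EuclideanSpace ℝ (Fin d))) :=
    {p | ρ ≤ ‖p.1‖ ∧ k ≤ pointCount (Metric.closedBall p.1 (r + δ)) p.2} with hTdef
  have hT : MeasurableSet T :=
    (measurableSet_le measurable_const measurable_fst.norm).inter
      (measurableSet_le measurable_const (measurable_pointCount_closedBall (r + δ)))
  set V := volume (Metric.closedBall (0 : EuclideanSpace ℝ (Fin d)) δ) with hV
  have hV0 : V ≠ 0 := (Metric.measure_closedBall_pos volume _ hδ).ne'
  have hVt : V ≠ ⊤ := measure_closedBall_lt_top.ne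
  have hsub : {x | ∃ m, ρ + δ ≤ ‖m‖ ∧ k ≤ pointCount (Metric.closedBall m r) x}
      ⊆ {x | V ≤ volume ((fun m => (m, x)) ⁻¹' T)} := by
    rintro x ⟨m, hm, hk⟩
    rw [Set.mem_ofPred_eq, hV, ← Measure.addHaar_closedBall_center volume m δ]
    refine measure_mono fun y hy => ⟨?_, hk.trans (pointCount_mono ?_ x)⟩
    · have h2 : ‖m - y‖ ≤ δ := by rw [← dist_eq_norm, dist_comm]; exact hy
      have h3 := norm_sub_norm_le m y
      show ρ ≤ ‖y‖
      linarith
    · refine Metric.closedBall_subset_closedBall' ?_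
      rw [dist_comm]
      have : dist y m ≤ δ := hy
      linarith
  have hlin : ∫⁻ x, volume ((fun m => (m, x)) ⁻¹' T) ∂(Measure.pi P)
      ≤ ENNReal.ofReal (K * n) *
        volume (Metric.closedBall (0 : EuclideanSpace ℝ (Fin d)) (r + δ)) := by
    rw [← Measure.prod_apply_symm hT, Measure.prod_apply hT]
    calc ∫⁻ m, Measure.pi P (Prod.mk m ⁻¹' T)
        ≤ ∫⁻ m, ENNReal.ofReal K * ∑ i, P i (Metric.closedBall m (r + δ)) := by
          refine lintegral_mono fun m => ?_
          by_cases hm : ρ ≤ ‖m‖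
          · have h1 : Prod.mk m ⁻¹' T
                = {x | k ≤ pointCount (Metric.closedBall m (r + δ)) x} := by
              ext x; simp [hTdef, hm]
            rw [h1, ← ofReal_measureReal]
            refine (ENNReal.ofReal_le_ofReal (h m hm)).trans_eq ?_
            rw [ENNReal.ofReal_mul hK,
              ENNReal.ofReal_sum_of_nonneg fun i _ => measureReal_nonneg]
            simp
          · have h1 : Prod.mk m ⁻¹' T = ∅ := by
              ext x; simp [hTdef, hm]
            simp [h1]
      _ = ENNReal.ofReal K * ∑ i : Fin n,
            volume (Metric.closedBall (0 : EuclideanSpace ℝ (Fin d)) (r + δ)) := by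
          have hmeas : ∀ i, Measurable fun m => P i (Metric.closedBall m (r + δ)) := fun i =>
            measurable_measure_prodMk_left (ν := P i)
              (measurableSet_dist_le (E := EuclideanSpace ℝ (Fin d)) (r + δ) measurable_id)
          rw [lintegral_const_mul _ (Finset.measurable_sum _ fun i _ => hmeas i),
            lintegral_finsetSum _ fun i _ => hmeas i]
          simp_rw [lintegral_measure_closedBall]
      _ = _ := by
          rw [ENNReal.ofReal_mul hK]
          simp [mul_assoc]
  have hmark := mul_meas_ge_le_lintegral (μ := Measure.pi P)
    (f := fun x => volume ((fun m => (m, x)) ⁻¹' T)) (measurable_measure_prodMk_right hT) V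
  have h4 := ((mul_le_mul_right (measure_mono hsub) V).trans hmark).trans hlin
  have h5 : volume (Metric.closedBall (0 : EuclideanSpace ℝ (Fin d)) (r + δ))
      = V * ENNReal.ofReal (((r + δ) / δ) ^ d) := by
    rw [hV, Measure.addHaar_closedBall _ _ hδ.le, Measure.addHaar_closedBall _ _ (by linarith),
      finrank_euclideanSpace_fin, mul_right_comm, ← ENNReal.ofReal_mul (by positivity), div_pow,
      mul_div_cancel₀ _ (by positivity)]
  rw [h5, mul_left_comm, ← ENNReal.ofReal_mul (by positivity)] at h4
  exact (ENNReal.mul_le_mul_iff_right hV0 hVt).1 h4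

end Balls

/-! ### The deviation bound for modal centres. -/

section Risk

variable {d n : ℕ}

lemma empiricalRisk_ballIndicator (x : Fin n → EuclideanSpace ℝ (Fin d))
    (m : EuclideanSpace ℝ (Fin d)) (r : ℝ) :
    empiricalRisk x (ballIndicator m r) = 1 / n * pointCount (Metric.closedBall m r) x := rfl

lemma IsModalBallCenter.pointCount_le (hn : 0 < n) {x : Fin n → EuclideanSpace ℝ (Fin d)} {r : ℝ}
    {m : EuclideanSpace ℝ (Fin d)} (h : IsModalBallCenter x r m) (y : EuclideanSpace ℝ (Fin d)) :
    pointCount (Metric.closedBall y r) x ≤ pointCount (Metric.closedBall m r) x := by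
  have h1 := h y
  rw [empiricalRisk_ballIndicator, empiricalRisk_ballIndicator] at h1
  have hn' : (0 : ℝ) < n := by exact_mod_cast hn
  exact le_of_mul_le_mul_left h1 (by positivity)

variable (P : Fin n → Measure (EuclideanSpace ℝ (Fin d)))

lemma populationRisk_ballIndicator (m : EuclideanSpace ℝ (Fin d)) (r : ℝ) :
    populationRisk P (ballIndicator m r) = 1 / n * ∑ i, (P i).real (Metric.closedBall m r) := by
  simp only [populationRisk, ballIndicator,
    integral_indicator_one Metric.isClosed_closedBall.measurableSet]

lemma nonempty_populationRisk_ballClass {r : ℝ} (hr : 0 ≤ r) :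
    (populationRisk P '' ballClass d r).Nonempty :=
  ⟨_, _, ⟨0, r, hr, le_rfl, rfl⟩, rfl⟩

variable [∀ i, IsProbabilityMeasure (P i)]

lemma measureReal_mixture (A : Set (EuclideanSpace ℝ (Fin d))) :
    (mixture P).real A = 1 / n * ∑ i, (P i).real A := by
  simp only [mixture, measureReal_def, Measure.smul_apply, Measure.finsetSum_apply, smul_eq_mul,
    ENNReal.toReal_mul, ENNReal.toReal_inv, ENNReal.toReal_natCast, one_div]
  rw [ENNReal.toReal_sum fun i _ => measure_ne_top _ _]

lemma isProbabilityMeasure_mixture (hn : n ≠ 0) : IsProbabilityMeasure (mixture P) := by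
  constructor
  simp [mixture, ENNReal.inv_mul_cancel, hn]

lemma populationRisk_ballIndicator_le_one (m : EuclideanSpace ℝ (Fin d)) (r : ℝ) :
    populationRisk P (ballIndicator m r) ≤ 1 := by
  rw [populationRisk_ballIndicator, one_div_mul_eq_div]
  refine div_le_one_of_le₀ ?_ n.cast_nonneg
  calc ∑ i, (P i).real (Metric.closedBall m r) ≤ ∑ _i : Fin n, (1 : ℝ) :=
        Finset.sum_le_sum fun i _ => measureReal_le_one
    _ = n := by simp

lemma bddAbove_populationRisk_ballClass (r : ℝ) :
    BddAbove (populationRisk P '' ballClass d r) := by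
  refine ⟨1, ?_⟩
  rintro _ ⟨_, ⟨m, s, -, -, rfl⟩, rfl⟩
  exact populationRisk_ballIndicator_le_one P m s

lemma populationRisk_le_RStar {m : EuclideanSpace ℝ (Fin d)} {r : ℝ} (hr : 0 ≤ r) :
    populationRisk P (ballIndicator m r) ≤ RStar P r :=
  le_csSup (bddAbove_populationRisk_ballClass P r) ⟨_, ⟨m, r, hr, le_rfl, rfl⟩, rfl⟩

lemma RStar_le_one {r : ℝ} (hr : 0 ≤ r) : RStar P r ≤ 1 := by
  refine csSup_le (nonempty_populationRisk_ballClass P hr) ?_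
  rintro _ ⟨_, ⟨m, s, -, -, rfl⟩, rfl⟩
  exact populationRisk_ballIndicator_le_one P m s

variable {P}

/-- Balls far from the origin have at most a quarter of the maximal mass. -/
lemma sum_measureReal_closedBall_le (hd : 1 ≤ d) (hn : n ≠ 0)
    (hQ : IsRadialUnimodal (mixture P)) {r : ℝ} (hr : 0 < r) (hR : 0 < RStar P r)
    {m : EuclideanSpace ℝ (Fin d)}
    (hm : 4 * r * (2 / RStar P r) ^ (1 / (d : ℝ)) - r / 4 ≤ ‖m‖) :
    ∑ i, (P i).real (Metric.closedBall m (r + r / 4)) ≤ n * RStar P r / 4 := by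
  have := isProbabilityMeasure_mixture P hn
  have hR1 := RStar_le_one P hr.le
  have hmix := measureReal_mixture P (Metric.closedBall m (r + r / 4))
  set Rs := RStar P r
  set y := (2 / Rs) ^ (1 / (d : ℝ)) with hy
  have hy1 : 1 ≤ y := Real.one_le_rpow (by rw [one_le_div hR]; linarith) (by positivity)
  have hyd : y ^ d = 2 / Rs := by
    rw [hy, one_div]
    exact Real.rpow_inv_natCast_pow (by positivity) (by lia)
  -- The distance condition reads `5/2 * r * y + 5/4 * r ≤ 4 * r * y - r / 4`, which is equivalent
  -- to `1 ≤ y`.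
  have h1 := hQ.measureReal_closedBall_mul_pow_le (x := m) (R := r + r / 4)
    (ρ := (r + r / 4) * (2 * y)) (by linarith) (by positivity) (by nlinarith)
  set q := (mixture P).real (Metric.closedBall m (r + r / 4))
  have hq : 0 ≤ q := measureReal_nonneg
  have hRd : 0 < (r + r / 4) ^ d := by positivity
  rw [mul_pow, mul_pow, hyd] at h1
  have h2 : q * (2 ^ d * (2 / Rs)) ≤ 1 := by
    refine le_of_mul_le_mul_left ?_ hRd
    linarith
  have h3 : (2 : ℝ) ≤ 2 ^ d := le_self_pow₀ one_le_two (by lia)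
  have h4 : q * (2 * (2 / Rs)) ≤ 1 := le_trans (by gcongr) h2
  have h5 : q ≤ Rs / 4 := by
    have h6 : q * (2 * (2 / Rs)) = 4 * q / Rs := by ring
    rw [h6, div_le_one hR] at h4
    linarith
  have hn' : (0 : ℝ) < n := by positivity
  have h7 : ∑ i, (P i).real (Metric.closedBall m (r + r / 4)) = n * q := by
    rw [hmix]; field_simp
  rw [h7]
  nlinarith

/-- The deviation bound for the modal ball estimator, under the product measure. -/
lemma measure_pi_norm_modalBallCenter_gt_le (hd : 1 ≤ d) (hn : 2 ≤ n)
    (hQ : IsRadialUnimodal (mixture P)) {r : ℝ} (hr : 0 < r)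
    (hR : concConst 0.5 * ((d + 1) * Real.log n / n) ≤ RStar P r) :
    Measure.pi P {x | ∃ m, IsModalBallCenter x r m ∧
        ¬ ‖m‖ ≤ 4 * r * (2 / RStar P r) ^ (1 / (d : ℝ))}
      ≤ ENNReal.ofReal (2 * Real.exp (-1 * d * Real.log n)) := by
  have hn' : (2 : ℝ) ≤ n := by exact_mod_cast hn
  have hd' : (1 : ℝ) ≤ d := by exact_mod_cast hd
  have hl : (0.69 : ℝ) ≤ Real.log n := by
    have h1 := Real.log_two_gt_d9
    have h2 := Real.log_le_log two_pos hn'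
    linarith
  have hexp : Real.exp (Real.log n) = n := Real.exp_log (by linarith)
  set l := Real.log n
  have hN : 82944 * ((d + 1) * l) ≤ n * RStar P r := by
    have h1 : concConst 0.5 = 82944 := by norm_num [concConst]
    rw [h1] at hR
    have h2 := mul_le_mul_of_nonneg_left hR (by linarith : (0 : ℝ) ≤ n)
    calc _ = n * (82944 * ((d + 1) * l / n)) := by field_simp
      _ ≤ _ := h2
  have hRpos : 0 < RStar P r := by
    have h1 : 0 < n * RStar P r := lt_of_lt_of_le (by positivity) hN
    exact pos_of_mul_pos_right h1 (by positivity)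
  -- A near-maximal ball suffices, so attainment of the supremum is not needed.
  obtain ⟨_, ⟨_, ⟨x₀, s, hs0, hsr, rfl⟩, rfl⟩, hx₀⟩ := exists_lt_of_lt_csSup
    (nonempty_populationRisk_ballClass P hr.le) (show 0.99 * RStar P r < RStar P r by linarith)
  rw [populationRisk_ballIndicator, one_div_mul_eq_div, lt_div_iff₀ (by linarith)] at hx₀
  have hfar := fun m => sum_measureReal_closedBall_le (m := m) hd (by lia) hQ hr hRpos
  set ρ := 4 * r * (2 / RStar P r) ^ (1 / (d : ℝ))
  set N := n * RStar P r with hNdef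
  have hdl : (d : ℝ) * l ≥ 0.69 := by nlinarith
  have hN1 : 82944 * (d * l) + 82944 * l ≤ N := by linarith
  have hsub : {x : Fin n → EuclideanSpace ℝ (Fin d) | ∃ m, IsModalBallCenter x r m ∧ ¬ ‖m‖ ≤ ρ}
      ⊆ {x | pointCount (Metric.closedBall x₀ s) x ≤ 3 * N / 4}
        ∪ {x | ∃ m, (ρ - r / 4) + r / 4 ≤ ‖m‖ ∧
            3 * N / 4 ≤ pointCount (Metric.closedBall m r) x} := by
    rintro x ⟨m, hm, hmρ⟩
    rcases le_total (pointCount (Metric.closedBall x₀ s) x) (3 * N / 4) with h | h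
    · exact Or.inl h
    · refine Or.inr ⟨m, by linarith, h.trans ?_⟩
      exact (pointCount_mono (Metric.closedBall_subset_closedBall hsr) x).trans
        (hm.pointCount_le (by lia) x₀)
  -- With `θ = 1/4` the exponent is at most `3N/16 - 0.198 * N = -0.0105 * N`, far below `-d * l`.
  have hA : Measure.pi P {x | pointCount (Metric.closedBall x₀ s) x ≤ 3 * N / 4}
      ≤ ENNReal.ofReal (Real.exp (-1 * d * l)) := by
    rw [← ofReal_measureReal]
    refine ENNReal.ofReal_le_ofReal ((measureReal_pointCount_le P
      Metric.isClosed_closedBall.measurableSet (θ := 1 / 4) (by norm_num) _).trans ?_)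
    rw [Real.exp_le_exp]
    have h1 : Real.exp (-(1 / 4)) ≤ 0.8 := by
      rw [Real.exp_neg]
      have := Real.add_one_le_exp (1 / 4 : ℝ)
      exact (inv_anti₀ (by norm_num) this).trans (by norm_num)
    have h2 : (Real.exp (-(1 / 4)) - 1) * ∑ i, (P i).real (Metric.closedBall x₀ s)
        ≤ -0.2 * (0.99 * N) := by
      have h3 : 0.99 * N ≤ ∑ i, (P i).real (Metric.closedBall x₀ s) := by
        rw [hNdef]; linarith
      nlinarith
    linarith
  have hN0 : 0 < N := by nlinarith
  have he1 : 2 ≤ Real.exp (3 * N / 4) := by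
    have := Real.add_one_le_exp (3 * N / 4)
    linarith
  have hB := measure_exists_pointCount_closedBall_le P (r := r) (δ := r / 4) (ρ := ρ - r / 4)
    (k := 3 * N / 4) (K := 2 * Real.exp (2 * (N / 4)) / (Real.exp (3 * N / 4) - 1)) hr.le
    (by linarith) (div_nonneg (by positivity) (by linarith)) fun m hm =>
      measureReal_le_pointCount P Metric.isClosed_closedBall.measurableSet (by linarith)
        (hfar m hm)
  -- The tail factor is at most `4 * exp (-N / 4)`; since `N / 4` is at least `20736 * (d * l + l)`,
  -- it absorbs `n` and the volume ratio `5 ^ d`.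
  have hB' : 2 * Real.exp (2 * (N / 4)) / (Real.exp (3 * N / 4) - 1) * n
      * ((r + r / 4) / (r / 4)) ^ d ≤ Real.exp (-1 * d * l) := by
    have h1 : (r + r / 4) / (r / 4) = 5 := by field_simp; norm_num
    have h2 : 2 * Real.exp (2 * (N / 4)) / (Real.exp (3 * N / 4) - 1)
        ≤ 4 * Real.exp (-(N / 4)) := by
      rw [div_le_iff₀ (by linarith)]
      have h3 : Real.exp (-(N / 4)) * Real.exp (3 * N / 4) = Real.exp (2 * (N / 4)) := by
        rw [← Real.exp_add]; congr 1; ring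
      nlinarith [Real.exp_pos (-(N / 4))]
    have h4 : (4 : ℝ) ≤ Real.exp (2 * l) := by
      rw [two_mul, Real.exp_add, hexp]; nlinarith
    have h5 : (5 : ℝ) ^ d ≤ Real.exp (3 * d * l) := by
      have h6 : 3 * d * l = d * (3 * l) := by ring
      have h7 : Real.exp (3 * l) = (n : ℝ) ^ 3 := by
        rw [← hexp, ← Real.exp_nat_mul]; simp
      rw [h6, Real.exp_nat_mul, h7]
      refine pow_le_pow_left₀ (by norm_num) ?_ d
      have : (2 : ℝ) ^ 3 ≤ n ^ 3 := by gcongr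
      linarith
    rw [h1]
    calc _ ≤ 4 * Real.exp (-(N / 4)) * n * 5 ^ d := by gcongr
      _ ≤ Real.exp (2 * l) * Real.exp (-(N / 4)) * Real.exp l * Real.exp (3 * d * l) := by
          rw [hexp]; gcongr
      _ = Real.exp (2 * l + -(N / 4) + l + 3 * d * l) := by
          rw [← Real.exp_add, ← Real.exp_add, ← Real.exp_add]
      _ ≤ _ := by
          rw [Real.exp_le_exp]
          nlinarith
  refine (measure_mono hsub).trans ((measure_union_le _ _).trans ?_)
  rw [two_mul, ENNReal.ofReal_add (Real.exp_pos _).le (Real.exp_pos _).le]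
  exact add_le_add hA (hB.trans (ENNReal.ofReal_le_ofReal hB'))

end Risk

/-! ### Order statistics and Chebyshev's inequality. -/

section OrderedStandardDeviations

variable {d n : ℕ}

lemma le_card_le_orderStat {a : Fin n → ENNReal} {k : ℕ} (h : orderStat a k ≠ ⊤) :
    k ≤ Nat.card {i // a i ≤ orderStat a k} := by
  set σ := orderStat a k with hσ
  -- The infimum is attained because finitely many values leave a gap above `σ`: any admissible `t <
  -- u` counts only indices with `a i ≤ σ`.
  have hlt : ∃ u, σ < u ∧ ∀ i, σ < a i → u ≤ a i := by
    by_cases hne : (Finset.univ.filter fun i => σ < a i).Nonempty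
    · refine ⟨(Finset.univ.filter fun i => σ < a i).inf' hne a, ?_, fun i hi => ?_⟩
      · rw [Finset.lt_inf'_iff]
        simp
      · exact Finset.inf'_le _ (by simpa using hi)
    · refine ⟨⊤, h.lt_top, fun i hi => (hne ⟨i, by simpa using hi⟩).elim⟩
  obtain ⟨u, hu, hau⟩ := hlt
  obtain ⟨t, ht, htu⟩ := sInf_lt_iff.1 hu
  refine le_trans ht (Nat.card_mono (Set.toFinite _) fun i hi => ?_)
  by_contra hcon
  exact absurd ((hau i (not_le.1 hcon)).trans hi) (not_le.2 htu)

/-- Chebyshev's inequality for a centred random vector. -/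
lemma measureReal_closedBall_ge_of_marginalSD_le (hd : 1 ≤ d)
    {Q : Measure (EuclideanSpace ℝ (Fin d))} [IsProbabilityMeasure Q] (h0 : ∫ z, z ∂Q = 0)
    {σ : ENNReal} (hσ : σ ≠ ⊤) (h : marginalSD Q ≤ σ) :
    3 / 4 ≤ Q.real (Metric.closedBall 0 (2 * Real.sqrt d * σ.toReal)) := by
  have hd' : (1 : ℝ) ≤ d := by exact_mod_cast hd
  set s := σ.toReal with hs
  have hs0 : 0 ≤ s := ENNReal.toReal_nonneg
  have hsum : ∑ j, evariance (fun z : EuclideanSpace ℝ (Fin d) => z j) Q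
      ≤ ENNReal.ofReal (d * s ^ 2) := by
    rw [marginalSD, one_div, ENNReal.rpow_inv_le_iff two_pos,
      ENNReal.div_le_iff (by simp; lia) (by simp), ENNReal.rpow_two] at h
    rwa [mul_comm, ENNReal.ofReal_mul (by positivity), ENNReal.ofReal_pow hs0, hs,
      ENNReal.ofReal_toReal hσ, ENNReal.ofReal_natCast]
  have hmeas : ∀ j, AEStronglyMeasurable (fun z : EuclideanSpace ℝ (Fin d) => z j) Q := fun j =>
    (by fun_prop : Measurable fun z : EuclideanSpace ℝ (Fin d) => z j).aestronglyMeasurable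
  have hL2 : ∀ j, MemLp (fun z : EuclideanSpace ℝ (Fin d) => z j) 2 Q := fun j =>
    (evariance_lt_top_iff_memLp (hmeas j)).1 ((Finset.single_le_sum
      (f := fun j => evariance (fun z : EuclideanSpace ℝ (Fin d) => z j) Q)
      (fun _ _ => zero_le) (Finset.mem_univ j)).trans_lt (hsum.trans_lt ENNReal.ofReal_lt_top))
  have hmean : ∀ j, ∫ z, z j ∂Q = 0 := fun j => by
    rw [← eval_integral_piLp fun j => (hL2 j).integrable one_le_two, h0]
    rfl
  have hnorm : ∫⁻ z, ENNReal.ofReal (‖z‖ ^ 2) ∂Q ≤ ENNReal.ofReal (d * s ^ 2) := by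
    refine le_of_eq_of_le ?_ hsum
    simp_rw [EuclideanSpace.real_norm_sq_eq, evariance_eq_lintegral_ofReal, hmean, sub_zero]
    rw [← lintegral_finsetSum _ fun j _ => by fun_prop]
    simp_rw [ENNReal.ofReal_sum_of_nonneg fun j _ => sq_nonneg _]
  -- For `s = 0` Markov's inequality has threshold zero and says nothing; then `Q` is concentrated
  -- at the origin.
  rcases hs0.eq_or_lt with hs1 | hs1
  · have h1 : ∫⁻ z, ENNReal.ofReal (‖z‖ ^ 2) ∂Q = 0 := by simpa [← hs1] using hnorm
    rw [lintegral_eq_zero_iff (by fun_prop)] at h1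
    have h2 : Metric.closedBall 0 (2 * Real.sqrt d * s) =ᵐ[Q] Set.univ := by
      refine Filter.eventuallyEq_univ.2 ?_
      filter_upwards [h1] with z hz
      have h3 : ‖z‖ ^ 2 ≤ 0 := ENNReal.ofReal_eq_zero.1 hz
      have h4 : ‖z‖ = 0 := pow_eq_zero_iff two_ne_zero |>.1 (h3.antisymm (sq_nonneg _))
      simp [← hs1, norm_eq_zero.1 h4]
    rw [measureReal_def, measure_congr h2, measure_univ]
    norm_num
  · have h1 := mul_meas_ge_le_lintegral (μ := Q)
      (f := fun z : EuclideanSpace ℝ (Fin d) => ENNReal.ofReal (‖z‖ ^ 2)) (by fun_prop)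
      (ENNReal.ofReal (4 * (d * s ^ 2)))
    have h2 := ENNReal.toReal_mono ENNReal.ofReal_ne_top (h1.trans hnorm)
    rw [ENNReal.toReal_mul, ENNReal.toReal_ofReal (by positivity),
      ENNReal.toReal_ofReal (by positivity), ← measureReal_def] at h2
    have h3 : (Metric.closedBall (0 : EuclideanSpace ℝ (Fin d)) (2 * Real.sqrt d * s))ᶜ
        ⊆ {z | ENNReal.ofReal (4 * (d * s ^ 2)) ≤ ENNReal.ofReal (‖z‖ ^ 2)} := by
      intro z hz
      have h4 : 2 * Real.sqrt d * s < ‖z‖ := by simpa using hz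
      refine ENNReal.ofReal_le_ofReal ?_
      calc 4 * (d * s ^ 2) = (2 * Real.sqrt d * s) ^ 2 := by
            rw [mul_pow, mul_pow, Real.sq_sqrt (by positivity)]; ring
        _ ≤ ‖z‖ ^ 2 := by gcongr
    have h5 := measureReal_mono (μ := Q) h3
    rw [probReal_compl_eq_one_sub Metric.isClosed_closedBall.measurableSet] at h5
    have h6 : 0 < d * s ^ 2 := by positivity
    nlinarith

/-- At least `2 * C * d * log n` laws give the centred ball mass `3/4`. The threshold `165888 = 2 *
288 ^ 2` pays for `d + 1 ≤ 2 * d`. -/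
lemma RStar_orderStat_ge (hd : 1 ≤ d) (hn : 2 ≤ n) (P : Fin n → Measure (EuclideanSpace ℝ (Fin d)))
    [∀ i, IsProbabilityMeasure (P i)] (h0 : ∀ i, ∫ z, z ∂(P i) = 0) {C : ℝ} (hC : 165888 ≤ C)
    {σ : ENNReal}
    (hσ : σ = orderStat (fun i => marginalSD (P i)) ⌈2 * C * d * Real.log n⌉₊) (hσt : σ ≠ ⊤) :
    concConst 0.5 * ((d + 1) * Real.log n / n) ≤ RStar P (2 * Real.sqrt d * σ.toReal) := by
  refine le_trans ?_ (populationRisk_le_RStar P (m := 0) (by positivity))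
  rw [populationRisk_ballIndicator]
  have hd' : (1 : ℝ) ≤ d := by exact_mod_cast hd
  have hn' : (2 : ℝ) ≤ n := by exact_mod_cast hn
  have hl : 0 < Real.log n := Real.log_pos (by linarith)
  have hcard := le_card_le_orderStat (hσ ▸ hσt)
  rw [← hσ, Nat.card_eq_fintype_card, Fintype.card_subtype] at hcard
  have h1 : 2 * C * d * Real.log n
      ≤ ((Finset.univ.filter fun i => marginalSD (P i) ≤ σ).card : ℝ) :=
    (Nat.le_ceil _).trans (by exact_mod_cast hcard)
  have h2 : ((Finset.univ.filter fun i => marginalSD (P i) ≤ σ).card : ℝ) * (3 / 4)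
      ≤ ∑ i, (P i).real (Metric.closedBall 0 (2 * Real.sqrt d * σ.toReal)) := by
    rw [← nsmul_eq_mul]
    refine (Finset.card_nsmul_le_sum _ _ _ fun i hi => ?_).trans
      (Finset.sum_le_univ_sum_of_nonneg fun i => measureReal_nonneg)
    exact measureReal_closedBall_ge_of_marginalSD_le hd (h0 i) hσt (by simpa using hi)
  have h3 : concConst 0.5 = 82944 := by norm_num [concConst]
  rw [h3, one_div_mul_eq_div, ← mul_div_assoc]
  gcongr
  have h4 : (d : ℝ) * Real.log n * 165888 ≤ d * Real.log n * C := by gcongr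
  nlinarith

end OrderedStandardDeviations

end ModalBall

/-! ### Transfer to the random vectors, and the choice of constants. -/

theorem mainTheorem4 :
    ∃ c' : ℝ, 0 < c' ∧ ∃ C₀ : ℝ, 0 < C₀ ∧ ∃ C' : ℝ, 0 < C' ∧
    ∀ (d n : ℕ), 1 ≤ d → 2 ≤ n →
    ∀ {Ω : Type*} [MeasurableSpace Ω] (ν : Measure Ω) [IsProbabilityMeasure ν]
      (X : Fin n → Ω → EuclideanSpace ℝ (Fin d))
      (P : Fin n → Measure (EuclideanSpace ℝ (Fin d))),
      (∀ i, HasLaw (X i) (P i) ν) → iIndepFun X ν →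
      ModalBall.IsRadialUnimodal (ModalBall.mixture P) →
      -- the bound for every radius that captures enough mass
      (∀ (r : ℝ) (μhat : Ω → EuclideanSpace ℝ (Fin d)), 0 < r →
        ModalBall.concConst 0.5 * ((d + 1) * Real.log n / n) ≤ ModalBall.RStar P r →
        (∀ ω, ModalBall.IsModalBallCenter (fun i => X i ω) r (μhat ω)) →
        -- the (outer) probability that the bound fails
        ν {ω | ¬ ‖μhat ω‖ ≤ 4 * r * (2 / ModalBall.RStar P r) ^ (1 / (d : ℝ))}
          ≤ ENNReal.ofReal (2 * Real.exp (-c' * d * Real.log n))) ∧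
      -- the bounds in terms of the ordered marginal standard deviations
      ((∀ i, ∫ z, z ∂(P i) = 0) →
        ∀ C : ℝ, C₀ ≤ C → ∀ σ : ENNReal,
          σ = ModalBall.orderStat (fun i => ModalBall.marginalSD (P i))
                ⌈2 * C * d * Real.log n⌉₊ →
          σ ≠ ⊤ →
          ModalBall.concConst 0.5 * ((d + 1) * Real.log n / n)
              ≤ ModalBall.RStar P (2 * Real.sqrt d * σ.toReal) ∧
          ∀ (r : ℝ) (μhat : Ω → EuclideanSpace ℝ (Fin d)), 0 < r →
            r ≤ 2 * Real.sqrt d * σ.toReal →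
            ModalBall.concConst 0.5 * ((d + 1) * Real.log n / n) ≤ ModalBall.RStar P r →
            (∀ ω, ModalBall.IsModalBallCenter (fun i => X i ω) r (μhat ω)) →
            ν {ω | ¬ (‖μhat ω‖
                    ≤ 8 * Real.sqrt d * σ.toReal * (2 / ModalBall.RStar P r) ^ (1 / (d : ℝ)) ∧
                  8 * Real.sqrt d * σ.toReal * (2 / ModalBall.RStar P r) ^ (1 / (d : ℝ))
                    ≤ 8 * Real.sqrt d * (n / (C' * d * Real.log n)) ^ (1 / (d : ℝ)) * σ.toReal)}
              ≤ ENNReal.ofReal (2 * Real.exp (-c' * d * Real.log n))) := by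
  refine ⟨1, one_pos, 165888, by norm_num, 1, one_pos, ?_⟩
  intro d n hd hn Ω _ ν _ X P hX hind hQ
  have hP : ∀ i, IsProbabilityMeasure (P i) := fun i => (hX i).isProbabilityMeasure_iff.1 inferInstance
  have hmod : ∀ (r : ℝ) (μhat : Ω → EuclideanSpace ℝ (Fin d)), 0 < r →
      ModalBall.concConst 0.5 * ((d + 1) * Real.log n / n) ≤ ModalBall.RStar P r →
      (∀ ω, ModalBall.IsModalBallCenter (fun i => X i ω) r (μhat ω)) →
      ν {ω | ¬ ‖μhat ω‖ ≤ 4 * r * (2 / ModalBall.RStar P r) ^ (1 / (d : ℝ))}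
        ≤ ENNReal.ofReal (2 * Real.exp (-1 * d * Real.log n)) := by
    intro r μhat hr hR hμ
    have hlaw : ν.map (fun ω i => X i ω) = Measure.pi P := by
      rw [hind.map_fun_eq_pi_map fun i => (hX i).aemeasurable]
      simp_rw [fun i => (hX i).map_eq]
    refine le_trans ?_ (ModalBall.measure_pi_norm_modalBallCenter_gt_le hd hn hQ hr hR)
    rw [← hlaw]
    -- `μhat` need not be measurable: the failure event lies in the preimage of an event about the
    -- sample alone, and `Measure.le_map_apply` holds for arbitrary sets.
    refine le_trans (measure_mono ?_)
      (Measure.le_map_apply (aemeasurable_pi_lambda _ fun i => (hX i).aemeasurable) _)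
    exact fun ω hω => ⟨μhat ω, hμ ω, hω⟩
  refine ⟨hmod, fun h0 C hC σ hσ hσt => ⟨ModalBall.RStar_orderStat_ge hd hn P h0 hC hσ hσt, ?_⟩⟩
  intro r μhat hr hrσ hR hμ
  refine le_trans (measure_mono ?_) (hmod r μhat hr hR hμ)
  intro ω hω hle
  -- Both remaining inequalities are deterministic, so no further probability is lost.
  refine hω ⟨hle.trans ?_, ?_⟩
  · have hR0 : 0 ≤ ModalBall.RStar P r := by
      refine le_trans ?_ hR
      have := Real.log_natCast_nonneg n
      unfold ModalBall.concConst
      positivity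
    refine mul_le_mul_of_nonneg_right ?_ (by positivity)
    linarith
  · have hd' : (1 : ℝ) ≤ d := by exact_mod_cast hd
    have hn' : (2 : ℝ) ≤ n := by exact_mod_cast hn
    have hl : 0 < Real.log n := Real.log_pos (by linarith)
    have hconst : ModalBall.concConst 0.5 = 82944 := by norm_num [ModalBall.concConst]
    have hR2 : 2 * (d * Real.log n) / n ≤ ModalBall.RStar P r := by
      refine le_trans ?_ hR
      rw [hconst, ← mul_div_assoc]
      gcongr ?_ / _
      nlinarith
    have hpos : 0 < 2 * (d * Real.log n) / n := by positivity
    have hdiv : 2 / ModalBall.RStar P r ≤ n / (1 * d * Real.log n) := by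
      refine (div_le_div_of_nonneg_left zero_le_two hpos hR2).trans_eq ?_
      field_simp
    have hpow : (2 / ModalBall.RStar P r) ^ (1 / (d : ℝ))
        ≤ (n / (1 * d * Real.log n)) ^ (1 / (d : ℝ)) :=
      Real.rpow_le_rpow (div_nonneg zero_le_two (hpos.le.trans hR2)) hdiv (by positivity)
    rw [mul_right_comm (8 * Real.sqrt d)]
    gcongr
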